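/- A lazy shortest-path problem consists of a finite directed graph $G=(V,E)$, two distinct vertices $v_{\mathrm{source}},v_{\mathrm{target}}$, positive lazy edge weights $\hat w:E\to\mathbb R_{>0}$ and true weights $w$ with $w(e)=\hat w(e)$ if $e$ is collision-free and $w(e)=\infty$ if $e$ is in collision. Initially no edge has been evaluated; evaluating $e$ reveals $w(e)$. For integers $\alpha\ge\beta\ge 1$, the algorithm LRA* with lookahead $\alpha$ and greediness $\beta$ maintains a search tree $T$ rooted at $v_{\mathrm{source}}$, with at most one node per vertex. The tree path to each vertex is the concatenation of an evaluated, collision-free head and a tail of edges that have not been evaluated; the number of edges in the tail is the budget of the vertex, and its key is the true cost of the head plus the lazy cost of the tail. A vertex of budget $\alpha$, or the target, is a frontier vertex and is not extended; every other vertex of $T$ that is a leaf is extended to its successors in the graph, in order of increasing keys, a vertex receiving a new parent whenever this does not increase its key (the subtree below it is then discarded and rebuilt by extension). When no more extension is possible, LRA* takes a frontier vertex of minimal key and evaluates, in order, the first $\beta$ edges of the tail of its tree path (all of them if there are fewer than $\beta$), stopping at the first edge found to be in collision. If $v_{\mathrm{target}}$ is reached by a collision-free edge, the algorithm terminates. Otherwise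 the edges found to be collision-free join the head and the keys and budgets below them are updated; an edge found to be in collision is deleted from the graph, and the vertices of the subtree below it are reattached, in order of increasing keys, to the best available parents in $T$ that are different from $v_{\mathrm{target}}$ and have budget less than $\alpha$, or leave $T$ if there are none. Then the tree is extended again, and so on. The algorithm also terminates when there is no frontier vertex left. Let $E_\beta$ denote the set of edges evaluated by LRA* with lookahead $\alpha$ and greediness $\beta$. **Lemma.** For all integers $\alpha,\beta_1,\beta_2$ with $\alpha\ge\beta_2>\beta_1>1$ there is a lazy shortest-path problem, in which no two different paths (with at least one edge each) have the same lazy cost, such that $$E_{\beta_1}\setminus E_{\beta_2}\neq\emptyset ,$$ for every rule by which the algorithm breaks ties between equal keys. -/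

import Mathlib

/-- A lazy shortest-path problem on a directed graph with vertex type `V`: edges `adj`, lazy
estimate `lazyW` of the edge weights (positive reals), true weights `w`, source and target.
The true weight of an edge is its lazy estimate if the edge is collision-free and infinite
if the edge is in collision. The values of `lazyW` and `w` off the edges are irrelevant. -/
structure LazyProblem (V : Type) where
  adj : V → V → Prop
  lazyW : V → V → ℝ
  w : V → V → WithTop ℝ
  source : V
  target : V
  lazyW_pos : ∀ u v, adj u v → 0 < lazyW u v
  w_eq : ∀ u v, adj u v → w u v = (lazyW u v : WithTop ℝ) ∨ w u v = ⊤
  source_ne_target : source ≠ target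

/-- The lazy cost of a path given as its sequence of vertices. -/
def LazyProblem.lazyCost {V : Type} (G : LazyProblem V) (p : List V) : ℝ :=
  ((p.zip p.tail).map fun e => G.lazyW e.1 e.2).sum

/-- No two different paths of the graph (sequences of at least two vertices in which consecutive
vertices are joined by an edge) have the same lazy cost. -/
def LazyProblem.DistinctPathCosts {V : Type} (G : LazyProblem V) : Prop :=
  ∀ p q : List V, p.IsChain G.adj → q.IsChain G.adj → 2 ≤ p.length → 2 ≤ q.length →
    G.lazyCost p = G.lazyCost q → p = q

/-- The rule by which a priority queue returns an element of minimal key; the rule decides how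
ties between elements with the same key are broken. -/
structure PopRule (V : Type) where
  pick : Set V → (V → WithTop ℝ) → V
  pick_mem : ∀ (Q : Set V) (k : V → WithTop ℝ), Q.Nonempty → pick Q k ∈ Q
  pick_le : ∀ (Q : Set V) (k : V → WithTop ℝ), ∀ x ∈ Q, k (pick Q k) ≤ k x

/-- Pop rules exist on every finite nonempty vertex set. -/
theorem PopRule.nonempty (V : Type) [Finite V] [Nonempty V] : Nonempty (PopRule V) := by
  classical
  have h : ∀ (Q : Set V) (k : V → WithTop ℝ), ∃ v : V,
      (Q.Nonempty → v ∈ Q) ∧ ∀ x ∈ Q, k v ≤ k x := by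
    intro Q k
    by_cases hQ : Q.Nonempty
    · obtain ⟨v, hv, hmin⟩ := Set.exists_min_image Q k Q.toFinite hQ
      exact ⟨v, fun _ => hv, hmin⟩
    · exact ⟨Classical.arbitrary V, fun h => absurd h hQ, fun x hx => absurd ⟨x, hx⟩ hQ⟩
  choose f hf using h
  exact ⟨⟨f, fun Q k => (hf Q k).1, fun Q k => (hf Q k).2⟩⟩

/-- The data stored with a vertex in the search tree: its parent (`none` for NIL), the cost `c`
of the evaluated part of the tree path to it, the lazy cost `l` of the part that is only lazily
evaluated, and the budget `b`, the number of edges in the latter part. -/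
structure TreeNode (V : Type) where
  parent : Option V
  c : ℝ
  l : ℝ
  b : ℕ

/-- The key `c + l` of a node; a vertex without a node has infinite key. -/
def nodeKey {V : Type} : Option (TreeNode V) → WithTop ℝ
  | none => ⊤
  | some t => ((t.c + t.l : ℝ) : WithTop ℝ)

/-- The memory of the algorithm. `tree v` is the node of `v` if `v` is in the search tree, and
`tent v` is the tentative node of a vertex `v` that waits in `qRewire`. -/
structure LRAState (V : Type) where
  tree : V → Option (TreeNode V)
  tent : V → Option (TreeNode V)
  edges : V → V → Prop
  qUpdate : Set V
  toRewire : Set V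
  qRewire : Set V
  qExtend : Set V
  qFrontier : Set V
  evaluated : Set (V × V)
  halted : Prop

/-- `s.IsChild u v`: the vertex `v` is in the search tree and its parent there is `u`. -/
def LRAState.IsChild {V : Type} (s : LRAState V) (u v : V) : Prop :=
  ∃ t, s.tree v = some t ∧ t.parent = some u

/-- The vertices of the subtree of the search tree that is rooted at `v`. -/
def LRAState.subtree {V : Type} (s : LRAState V) (v : V) : Set V :=
  {x | s.tree x ≠ none ∧ Relation.ReflTransGen s.IsChild v x}

/-- The last `n + 1` vertices on the tree path that ends in `v`; for `n` the budget of `v` these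
are the vertices of the lazily evaluated tail of that path, starting with its border vertex. -/
def LRAState.tail {V : Type} (s : LRAState V) : ℕ → V → List V
  | 0, v => [v]
  | n + 1, v =>
    match (s.tree v).bind TreeNode.parent with
    | none => [v]
    | some u => s.tail n u ++ [v]

namespace LazyProblem

variable {V : Type}

/-- The node of `v` as a child of `u` with node `t`, the edge `(u, v)` not being evaluated. -/
def childNode (G : LazyProblem V) (u : V) (t : TreeNode V) (v : V) : TreeNode V :=
  ⟨some u, t.c, t.l + G.lazyW u v, t.b + 1⟩

open Classical in
/-- Only the source is in the search tree, and it waits to be extended. -/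
noncomputable def initState (G : LazyProblem V) : LRAState V where
  tree v := if v = G.source then some ⟨none, 0, 0, 0⟩ else none
  tent _ := none
  edges := G.adj
  qUpdate := ∅
  toRewire := ∅
  qRewire := ∅
  qExtend := {G.source}
  qFrontier := ∅
  evaluated := ∅
  halted := False

open Classical in
/-- Evaluate up to `n` edges along the given path, in order, stopping early at the first edge in
collision, when the target is reached, or at the end of the path. A collision-free edge moves its
end vertex to the evaluated part of the tree; an edge in collision is removed from the graph, and
the subtree below it has to be rewired. -/
noncomputable def evaluatePath (G : LazyProblem V) :
    ℕ → List V → LRAState V → LRAState V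
  | n + 1, u :: v :: p, s =>
    if G.w u v = (G.lazyW u v : WithTop ℝ) then
      let cu : ℝ := ((s.tree u).map TreeNode.c).getD 0
      let s' : LRAState V :=
        { s with
          tree := fun x => if x = v then some ⟨some u, cu + G.lazyW u v, 0, 0⟩ else s.tree x
          qUpdate := insert v s.qUpdate
          evaluated := insert (u, v) s.evaluated }
      if v = G.target then { s' with halted := True }
      else G.evaluatePath n (v :: p) s'
    else
      { s with
        edges := fun x y => s.edges x y ∧ (x, y) ≠ (u, v)
        toRewire := s.subtree v
        evaluated := insert (u, v) s.evaluated }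
  | _, _, s => s

/-- Take a frontier vertex of minimal key and evaluate the first `β` edges along the tail of its
tree path. -/
noncomputable def searchStep (G : LazyProblem V) (R : PopRule V) (β : ℕ) (s : LRAState V) :
    LRAState V :=
  let v := R.pick s.qFrontier fun x => nodeKey (s.tree x)
  let b : ℕ := ((s.tree v).map TreeNode.b).getD 0
  G.evaluatePath β (s.tail b v) { s with qFrontier := s.qFrontier \ {v} }

open Classical in
/-- One iteration of the update loop: propagate the new data of a vertex to its children in the
tree. Children that have been evaluated themselves (budget `0`) or whose subtree has to be rewired
are not touched. -/
noncomputable def updateStep (G : LazyProblem V) (R : PopRule V) (α : ℕ) (s : LRAState V) :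
    LRAState V :=
  let u := R.pick s.qUpdate fun x => nodeKey (s.tree x)
  let q := s.qUpdate \ {u}
  match s.tree u with
  | none => { s with qUpdate := q }
  | some t =>
    if ∃ v, s.IsChild u v then
      let ch : Set V := {v | ∃ t', s.tree v = some t' ∧ t'.parent = some u ∧ 0 < t'.b ∧
        v ∉ s.toRewire}
      { s with
        tree := fun v => if v ∈ ch then some (G.childNode u t v) else s.tree v
        qFrontier := s.qFrontier \ {v | v ∈ ch ∧ ∃ t', s.tree v = some t' ∧ t'.b = α}
        qUpdate := q ∪ ch }
    else { s with qUpdate := q, qExtend := insert u s.qExtend }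

open Classical in
/-- Remove all vertices that have to be rewired from the tree and from the frontier, and compute
for each of them the best parent outside of the removed set, if there is one. -/
noncomputable def startRewire (G : LazyProblem V) (R : PopRule V) (α : ℕ) (s : LRAState V) :
    LRAState V :=
  let parents : V → Set V := fun v => {u | u ∉ s.toRewire ∧ u ∉ s.qExtend ∧ u ≠ G.target ∧
    s.edges u v ∧ ∃ t, s.tree u = some t ∧ t.b < α}
  let best : V → V := fun v =>
    R.pick (parents v) fun u => nodeKey (s.tree u) + (G.lazyW u v : WithTop ℝ)
  { s with
    tree := fun v => if v ∈ s.toRewire then none else s.tree v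
    tent := fun v =>
      if v ∈ s.toRewire ∧ (parents v).Nonempty then
        (s.tree (best v)).map fun t => G.childNode (best v) t v
      else none
    qFrontier := s.qFrontier \ s.toRewire
    qRewire := s.toRewire
    toRewire := ∅ }

open Classical in
/-- One iteration of the rewiring loop: put a vertex with its best parent into the tree, and offer
it as a parent to the vertices that still wait to be rewired. -/
noncomputable def rewireStep (G : LazyProblem V) (R : PopRule V) (α : ℕ) (s : LRAState V) :
    LRAState V :=
  let u := R.pick s.qRewire fun x => nodeKey (s.tent x)
  let q := s.qRewire \ {u}
  match s.tent u with
  | none => { s with qRewire := q }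
  | some t =>
    let s' : LRAState V :=
      { s with
        tree := fun x => if x = u then some t else s.tree x
        qRewire := q }
    if t.b = α ∨ u = G.target then { s' with qFrontier := insert u s.qFrontier }
    else
      { s' with
        qExtend := insert u s.qExtend
        tent := fun v =>
          if s.edges u v ∧ v ∈ q ∧ nodeKey (some (G.childNode u t v)) < nodeKey (s.tent v) then
            some (G.childNode u t v)
          else s.tent v }

open Classical in
/-- One iteration of the loop that extends the band. The target is not extended but made a
frontier vertex. Otherwise the successors of the vertex to which the path through it is at least
as good as their current tree path are removed from the tree together with their subtrees, and all
successors that are not in the tree now become children of the vertex. -/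
noncomputable def extendStep (G : LazyProblem V) (R : PopRule V) (α : ℕ) (s : LRAState V) :
    LRAState V :=
  let u := R.pick s.qExtend fun x => nodeKey (s.tree x)
  let q := s.qExtend \ {u}
  match s.tree u with
  | none => { s with qExtend := q }
  | some t =>
    if u = G.target then { s with qExtend := q, qFrontier := insert u s.qFrontier }
    else
      let cut : Set V := {x | ∃ v, s.edges u v ∧
        nodeKey (some (G.childNode u t v)) ≤ nodeKey (s.tree v) ∧ x ∈ s.subtree v}
      let new : Set V := {v | s.edges u v ∧ (v ∈ cut ∨ s.tree v = none)}
      { s with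
        tree := fun x =>
          if x ∈ new then some (G.childNode u t x) else if x ∈ cut then none else s.tree x
        qFrontier := (s.qFrontier \ cut) ∪ {v | v ∈ new ∧ t.b + 1 = α}
        qExtend := (q \ cut) ∪ {v | v ∈ new ∧ t.b + 1 ≠ α} }

open Classical in
/-- One step of LRA* with lookahead `α` and greediness `β`. After every evaluation of edges the
search tree is first updated, then rewired, then extended, and when that is finished the next
frontier vertex is chosen. The algorithm stops when the target has been reached by collision-free
edges, or when the frontier is empty. -/
noncomputable def lraStep (G : LazyProblem V) (R : PopRule V) (α β : ℕ) (s : LRAState V) :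
    LRAState V :=
  if s.halted then s
  else if s.qUpdate.Nonempty then G.updateStep R α s
  else if s.toRewire.Nonempty then G.startRewire R α s
  else if s.qRewire.Nonempty then G.rewireStep R α s
  else if s.qExtend.Nonempty then G.extendStep R α s
  else if s.qFrontier.Nonempty then G.searchStep R β s
  else s

/-- The set of edges that LRA* with lookahead `α` and greediness `β` evaluates. -/
def evaluatedEdges (G : LazyProblem V) (R : PopRule V) (α β : ℕ) : Set (V × V) :=
  {e | ∃ n : ℕ, e ∈ ((G.lraStep R α β)^[n] G.initState).evaluated}

end LazyProblem

/-! The witness is a collision-free tree with a fork just behind the reach of the smaller greediness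
`b = β₁`. A path `0, …, α` starts in the source `0`, a branch `α + 1, …, 2 * α - 1` leaves it in `b
+ 1`, and the target `2 * α` is a direct successor of the source. The edge into `i` costs `2 ^ i`,
so the distance from the source increases strictly with the number of the vertex. Hence keys never
tie, the rule `R` has no influence, and the target is the last choice in every frontier.

For every greediness `β ≤ α` the first search picks the vertex `α` and evaluates the first `β` edges
of the path. If `β = b`, the head ends one edge before the fork. The tail `b, b + 1, α + 1, …, 2 * α
- 1` then has exactly `α` edges, so its end becomes a frontier vertex and is preferred to the
target; since `b > 1`, its second edge `(b + 1, α + 1)` is evaluated. If `β > b`, the head contains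
the fork, so the branch is one edge too short to reach budget `α`. The target is the only frontier
vertex left, and the algorithm stops after evaluating the edge to it.

In a collision-free arborescence the parents and keys of tree nodes are forced, nothing is rewired,
and only the budgets depend on what has been evaluated. This is recorded by invariants that are
parametrised by a budget function: `ExtendInv.exists_iterate` and `UpdateInv.exists_iterate` run the
loops to their end, and `ExtendInv.lraStep_spine` performs the first search. The two cases of the
second search are `ForkedTree.branch_mem` and `ForkedTree.branch_notMem`. -/

namespace LazyProblem

variable {V : Type}

/-! ### Collision-free arborescences and the invariants of the phases -/

/-- The edges of `G` form a tree rooted at the source and are collision-free; `par` is the parent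
map of this tree, and `depth` and `dist` are the number of edges and the lazy cost of the path from
the source to a vertex. -/
structure IsArborescence (G : LazyProblem V) (par : V → V) (depth : V → ℕ) (dist : V → ℝ) :
    Prop where
  adj_iff : ∀ u v, G.adj u v ↔ v ≠ G.source ∧ u = par v
  free : ∀ u v, G.adj u v → G.w u v = (G.lazyW u v : WithTop ℝ)
  depth_source : depth G.source = 0
  depth_par : ∀ v, v ≠ G.source → depth v = depth (par v) + 1
  dist_source : dist G.source = 0
  dist_par : ∀ v, v ≠ G.source → dist v = dist (par v) + G.lazyW (par v) v
  par_ne_target : ∀ v, v ≠ G.source → par v ≠ G.target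
  dist_injective : Function.Injective dist

/-- The function `bud` is the budget of the vertices when those with `bud v = 0` have been
evaluated. -/
structure IsBudget (G : LazyProblem V) (par : V → V) (bud : V → ℕ) : Prop where
  source : bud G.source = 0
  succ : ∀ v, bud v ≠ 0 → bud v = bud (par v) + 1

/-- The part of the invariant of LRA* on a collision-free arborescence that is common to all of its
phases. -/
structure TreeInv (G : LazyProblem V) (par : V → V) (dist : V → ℝ) (s : LRAState V) : Prop where
  not_halted : ¬ s.halted
  edges : s.edges = G.adj
  toRewire : s.toRewire = ∅
  qRewire : s.qRewire = ∅
  source : s.tree G.source = some ⟨none, 0, 0, 0⟩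
  node : ∀ v t, v ≠ G.source → s.tree v = some t → t.parent = some (par v)
  key : ∀ v t, s.tree v = some t → t.c + t.l = dist v
  par_mem : ∀ v, v ≠ G.source → s.tree v ≠ none → s.tree (par v) ≠ none

/-- The invariant of the extension phase. -/
structure ExtendInv (G : LazyProblem V) (α : ℕ) (par : V → V) (dist : V → ℝ) (bud : V → ℕ)
    (s : LRAState V) : Prop extends TreeInv G par dist s where
  qUpdate : s.qUpdate = ∅
  budget : ∀ v t, s.tree v = some t → t.b = bud v
  budget_le : ∀ v, s.tree v ≠ none → bud v ≤ α
  head_mem : ∀ v, bud v = 0 → s.tree v ≠ none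
  par_notMem : ∀ v, v ≠ G.source → s.tree v ≠ none → par v ∉ s.qExtend
  extended : ∀ v, v ≠ G.source → s.tree (par v) ≠ none → par v ∉ s.qExtend → bud (par v) < α →
    s.tree v ≠ none
  qExtend : ∀ v ∈ s.qExtend, s.tree v ≠ none ∧ bud v < α
  qFrontier : ∀ v, v ∈ s.qFrontier ↔
    s.tree v ≠ none ∧ (bud v = α ∨ v = G.target ∧ v ∉ s.qExtend)

/-- The invariant of the update phase after the first evaluation of edges, when the tree consists
of the vertices of depth at most `α`. -/
structure UpdateInv (G : LazyProblem V) (α : ℕ) (par : V → V) (depth : V → ℕ) (dist : V → ℝ)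
    (bud : V → ℕ) (s : LRAState V) : Prop extends TreeInv G par dist s where
  mem_iff : ∀ v, s.tree v ≠ none ↔ depth v ≤ α
  head : ∀ v t, s.tree v = some t → (t.b = 0 ↔ bud v = 0)
  local_budget : ∀ v t, s.tree v = some t → bud v ≠ 0 → par v ∈ s.qUpdate ∨
    ∃ t', s.tree (par v) = some t' ∧ t.b = t'.b + 1
  queued : ∀ v t, s.tree v = some t → depth v = α → v ∈ s.qExtend ∨ v ∈ s.qUpdate ∨ t.b = α
  mem_queue : ∀ v, v ∈ s.qExtend ∨ v ∈ s.qUpdate → s.tree v ≠ none ∧ v ≠ G.source ∧ v ≠ G.target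
  childless : ∀ v, v ≠ G.source → s.tree v ≠ none → par v ∉ s.qExtend
  target_mem : G.target ∈ s.qFrontier
  qFrontier : ∀ v ∈ s.qFrontier, v = G.target ∨ ∃ t, s.tree v = some t ∧ t.b = α

variable {G : LazyProblem V} {α β : ℕ} {par : V → V} {depth : V → ℕ} {dist : V → ℝ}
  {bud : V → ℕ} {s : LRAState V}

theorem IsArborescence.par_ne (hG : G.IsArborescence par depth dist) {v : V}
    (hv : v ≠ G.source) : par v ≠ v := by
  intro h
  have := hG.depth_par v hv
  rw [h] at this
  omega

theorem IsArborescence.dist_par_lt (hG : G.IsArborescence par depth dist) {v : V}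
    (hv : v ≠ G.source) : dist (par v) < dist v := by
  rw [hG.dist_par v hv]
  have := G.lazyW_pos (par v) v ((hG.adj_iff _ _).2 ⟨hv, rfl⟩)
  linarith

theorem TreeInv.isChild_iff (h : G.TreeInv par dist s) (u v : V) :
    s.IsChild u v ↔ v ≠ G.source ∧ u = par v ∧ s.tree v ≠ none := by
  constructor
  · rintro ⟨t, ht, hp⟩
    have hv : v ≠ G.source := by
      rintro rfl
      rw [h.source] at ht
      cases ht
      cases hp
    refine ⟨hv, ?_, by simp [ht]⟩
    have := h.node v t hv ht
    rw [hp] at this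
    exact Option.some.inj this
  · rintro ⟨hv, rfl, ht⟩
    obtain ⟨t, ht⟩ := Option.ne_none_iff_exists'.1 ht
    exact ⟨t, ht, h.node v t hv ht⟩

theorem TreeInv.nodeKey_eq (h : G.TreeInv par dist s) {v : V} (hv : s.tree v ≠ none) :
    nodeKey (s.tree v) = (dist v : WithTop ℝ) := by
  obtain ⟨t, ht⟩ := Option.ne_none_iff_exists'.1 hv
  rw [ht, ← h.key v t ht]
  rfl

/-- The subtree of a vertex outside of the search tree is empty. -/
theorem TreeInv.subtree_eq_empty (h : G.TreeInv par dist s) {v : V} (hv : s.tree v = none) :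
    s.subtree v = ∅ := by
  ext x
  simp only [LRAState.subtree, Set.mem_ofPred_eq, Set.mem_empty_iff_false, iff_false, not_and]
  intro hx hvx
  rcases Relation.ReflTransGen.cases_head hvx with rfl | ⟨y, hy, -⟩
  · exact hx hv
  · obtain ⟨h1, rfl, h3⟩ := (h.isChild_iff _ _).1 hy
    exact h.par_mem y h1 h3 hv

/-! ### The extension phase -/

/-- The vertices that are still to be added or to be extended. -/
def pending (s : LRAState V) : Set V := {v | s.tree v = none ∨ v ∈ s.qExtend}

/-- A vertex that waits for extension has no children in the search tree, and each successor has no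
other possible parent, so an extension never cuts anything. The extended vertex ceases to be
pending, while the vertices it adds were pending before, being outside of the tree. -/
theorem ExtendInv.extendStep (hG : G.IsArborescence par depth dist)
    (hb : G.IsBudget par bud) (R : PopRule V) (h : G.ExtendInv α par dist bud s)
    (hs : s.qExtend.Nonempty) :
    G.ExtendInv α par dist bud (G.extendStep R α s) ∧
      (G.extendStep R α s).evaluated = s.evaluated ∧
      pending (G.extendStep R α s) ⊂ pending s := by
  classical
  set u := R.pick s.qExtend fun x => nodeKey (s.tree x) with hu
  have huq : u ∈ s.qExtend := R.pick_mem _ _ hs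
  obtain ⟨hut, hub⟩ := h.qExtend u huq
  obtain ⟨t, ht⟩ := Option.ne_none_iff_exists'.1 hut
  have hnc : ∀ v, v ≠ G.source → u = par v → s.tree v = none := by
    intro v hv huv
    by_contra hc
    exact h.par_notMem v hv hc (huv ▸ huq)
  by_cases hT : u = G.target
  · have e : G.extendStep R α s =
        { s with qExtend := s.qExtend \ {u}, qFrontier := insert u s.qFrontier } := by
      simp only [LazyProblem.extendStep, ← hu, ht, if_pos hT]
    rw [e]
    refine ⟨{ not_halted := h.not_halted, edges := h.edges, toRewire := h.toRewire,
              qRewire := h.qRewire, source := h.source, node := h.node, key := h.key,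
              par_mem := h.par_mem, qUpdate := h.qUpdate, budget := h.budget,
              budget_le := h.budget_le,
              head_mem := h.head_mem, par_notMem := ?_, extended := ?_, qExtend := ?_,
              qFrontier := ?_ }, rfl, ?_⟩
    · intro v hv htv hm
      exact h.par_notMem v hv htv hm.1
    · intro v hv h1 h2 h3
      -- The target leaves the queue without receiving children; this is harmless because it is
      -- nobody's parent.
      refine h.extended v hv h1 (fun hm => h2 ⟨hm, ?_⟩) h3
      rw [Set.mem_singleton_iff, hT]
      exact hG.par_ne_target v hv
    · intro v hv
      exact h.qExtend v hv.1
    · intro v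
      simp only [Set.mem_insert_iff, h.qFrontier, Set.mem_sdiff, Set.mem_singleton_iff]
      by_cases hvu : v = u
      · subst hvu; simp [hut, ← hT]
      · simp [hvu]
    · refine ⟨?_, fun hc => ?_⟩
      · rintro v (hv | hv)
        · exact Or.inl hv
        · exact Or.inr hv.1
      · rcases hc (Or.inr huq : u ∈ pending s) with hv | hv
        · exact hut hv
        · exact hv.2 rfl
  · set new : Set V := {v | v ≠ G.source ∧ u = par v} with hnew
    have hun : u ∉ new := fun hm => hG.par_ne hm.1 hm.2.symm
    have hnn : ∀ v ∈ new, s.tree v = none := fun v hv => hnc v hv.1 hv.2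
    -- Evaluated vertices are already in the tree, so a new vertex has nonzero budget, which is one
    -- more than that of its parent.
    have hnb : ∀ v ∈ new, bud v = bud u + 1 := by
      intro v hv
      rw [hb.succ v fun h0 => h.head_mem v h0 (hnn v hv), hv.2]
    have hcut : {x | ∃ v, s.edges u v ∧
        nodeKey (some (G.childNode u t v)) ≤ nodeKey (s.tree v) ∧ x ∈ s.subtree v} = ∅ := by
      ext x
      simp only [Set.mem_ofPred_eq, Set.mem_empty_iff_false, iff_false, not_exists, not_and, h.edges,
        hG.adj_iff]
      intro v hv _
      rw [h.subtree_eq_empty (hnn v hv)]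
      exact Set.notMem_empty x
    have hnew' : {v | s.edges u v ∧ (v ∈ (∅ : Set V) ∨ s.tree v = none)} = new := by
      ext v
      simp only [Set.mem_ofPred_eq, Set.mem_empty_iff_false, false_or, h.edges, hG.adj_iff, hnew,
        and_iff_left_iff_imp]
      exact fun hv => hnc v hv.1 hv.2
    have hbt : t.b = bud u := h.budget u t ht
    have e : G.extendStep R α s =
        { s with
          tree := fun x => if x ∈ new then some (G.childNode u t x) else s.tree x
          qFrontier := s.qFrontier ∪ {v | v ∈ new ∧ bud u + 1 = α}
          qExtend := (s.qExtend \ {u}) ∪ {v | v ∈ new ∧ bud u + 1 ≠ α} } := by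
      simp only [LazyProblem.extendStep, ← hu, ht, if_neg hT, hcut, hnew', ← hbt]
      simp
    rw [e]
    have htree : ∀ x, (if x ∈ new then some (G.childNode u t x) else s.tree x) = none ↔
        x ∉ new ∧ s.tree x = none := by
      intro x; split_ifs with hx <;> simp [hx]
    refine ⟨{ not_halted := h.not_halted, edges := h.edges, toRewire := h.toRewire,
              qRewire := h.qRewire, source := ?_, node := ?_, key := ?_,
              par_mem := ?_, qUpdate := h.qUpdate, budget := ?_, budget_le := ?_,
              head_mem := ?_, par_notMem := ?_, extended := ?_, qExtend := ?_,
              qFrontier := ?_ }, rfl, ?_⟩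
    · simp [hnew, h.source]
    · intro v t' hv htv
      dsimp only at htv
      split_ifs at htv with hx
      · cases htv; simp [childNode, hx.2]
      · exact h.node v t' hv htv
    · intro v t' htv
      dsimp only at htv
      split_ifs at htv with hx
      · cases htv
        rw [hG.dist_par v hx.1, ← hx.2, ← h.key u t ht]
        simp [childNode, add_assoc]
      · exact h.key v t' htv
    · intro v hv
      dsimp only
      rw [Ne, htree, Ne, htree]
      rintro h1 ⟨h2, h3⟩
      by_cases hx : v ∈ new
      · rw [← hx.2] at h3; exact hut h3
      · exact h.par_mem v hv (fun h4 => h1 ⟨hx, h4⟩) h3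
    · intro v t' htv
      dsimp only at htv
      split_ifs at htv with hx
      · cases htv
        rw [hnb v hx, ← hbt]; rfl
      · exact h.budget v t' htv
    · intro v
      dsimp only
      rw [Ne, htree]
      intro h1
      by_cases hx : v ∈ new
      · rw [hnb v hx]; omega
      · exact h.budget_le v fun h3 => h1 ⟨hx, h3⟩
    · intro v hv
      dsimp only
      rw [Ne, htree]
      exact fun h1 => h.head_mem v hv h1.2
    · intro v hv
      dsimp only
      rw [Ne, htree]
      rintro h1 (h2 | h2)
      · by_cases hx : v ∈ new
        · exact h2.2 hx.2.symm
        · exact h.par_notMem v hv (fun h3 => h1 ⟨hx, h3⟩) h2.1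
      · by_cases hx : v ∈ new
        · exact hun (hx.2 ▸ h2.1)
        · exact h.par_mem v hv (fun h3 => h1 ⟨hx, h3⟩) (hnn _ h2.1)
    · intro v hv
      simp only [ne_eq, htree]
      rintro h1 h2 h3 ⟨h4, h5⟩
      have hpu : par v ≠ u := fun hc => h4 ⟨hv, hc.symm⟩
      by_cases hx : par v ∈ new
      · exact h2 (Or.inr ⟨hx, by have := hnb _ hx; omega⟩)
      · refine h.extended v hv (fun hc => h1 ⟨hx, hc⟩) (fun hc => h2 (Or.inl ⟨hc, hpu⟩)) h3 h5
    · intro v hv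
      dsimp only
      rw [Ne, htree]
      rcases hv with hv | hv
      · obtain ⟨h1, h2⟩ := h.qExtend v hv.1
        exact ⟨fun h3 => h1 h3.2, h2⟩
      · refine ⟨fun h3 => h3.1 hv.1, ?_⟩
        have := hnb v hv.1
        have := hv.2
        omega
    · intro v
      dsimp only
      rw [Ne, htree]
      simp only [Set.mem_union, Set.mem_ofPred_eq, h.qFrontier, Set.mem_sdiff, Set.mem_singleton_iff]
      by_cases hx : v ∈ new
      · have := hnb v hx
        have h1 := hnn v hx
        have : v ∉ s.qExtend := fun hc => (h.qExtend v hc).1 h1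
        simp only [hx, h1, this]
        rw [hnb v hx]
        simp
      · simp only [hx]
        by_cases hvu : v = u
        · subst hvu; simp [hT]
        · simp [hvu]
    · refine ⟨?_, fun hc => ?_⟩
      · rintro v (hv | hv)
        · exact Or.inl ((htree v).1 hv).2
        · rcases hv with hv | hv
          · exact Or.inr hv.1
          · exact Or.inl (hnn v hv.1)
      · rcases hc (Or.inr huq : u ∈ pending s) with hv | hv
        · exact hut ((htree u).1 hv).2
        · rcases hv with hv | hv
          · exact hv.2 rfl
          · exact hun hv.1

theorem ExtendInv.lraStep_eq (R : PopRule V) (h : G.ExtendInv α par dist bud s)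
    (hs : s.qExtend.Nonempty) : G.lraStep R α β s = G.extendStep R α s := by
  simp [lraStep, h.not_halted, h.qUpdate, h.toRewire, h.qRewire, hs]

/-- The extension phase terminates. -/
theorem ExtendInv.exists_iterate [Finite V] (hG : G.IsArborescence par depth dist)
    (hb : G.IsBudget par bud) (R : PopRule V) (h : G.ExtendInv α par dist bud s) :
    ∃ n, G.ExtendInv α par dist bud ((G.lraStep R α β)^[n] s) ∧
      ((G.lraStep R α β)^[n] s).qExtend = ∅ ∧
      ((G.lraStep R α β)^[n] s).evaluated = s.evaluated := by
  induction hp : (pending s).ncard using Nat.strong_induction_on generalizing s with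
  | _ m ih =>
    rcases s.qExtend.eq_empty_or_nonempty with h0 | h0
    · exact ⟨0, h, h0, rfl⟩
    · obtain ⟨h1, h2, h3⟩ := h.extendStep hG hb R h0
      obtain ⟨n, h4, h5, h6⟩ := ih _ (hp ▸ Set.ncard_lt_ncard h3 (Set.toFinite _)) h1 rfl
      refine ⟨n + 1, ?_⟩
      rw [Function.iterate_succ_apply, h.lraStep_eq R h0]
      exact ⟨h4, h5, h6.trans h2⟩

/-- After the extension phase the tree consists of the vertices whose budget is at most `α`. -/
theorem ExtendInv.mem_iff (hb : G.IsBudget par bud) (h : G.ExtendInv α par dist bud s)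
    (hs : s.qExtend = ∅) (v : V) : s.tree v ≠ none ↔ bud v ≤ α := by
  refine ⟨h.budget_le v, ?_⟩
  induction hn : bud v generalizing v with
  | zero => exact fun _ => h.head_mem v hn
  | succ n ih =>
    intro hv
    have h1 := hb.succ v (by omega)
    refine h.extended v ?_ (ih _ (by omega) (by omega)) (by simp [hs]) (by omega)
    rintro rfl
    rw [hb.source] at hn
    omega

theorem ExtendInv.mem_qFrontier (hb : G.IsBudget par bud) (h : G.ExtendInv α par dist bud s)
    (hs : s.qExtend = ∅) (v : V) :
    v ∈ s.qFrontier ↔ bud v = α ∨ v = G.target ∧ bud v ≤ α := by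
  rw [h.qFrontier, h.mem_iff hb hs]
  simp only [hs, Set.mem_empty_iff_false, not_false_eq_true, and_true]
  constructor
  · rintro ⟨h1, h2 | h2⟩
    · exact Or.inl h2
    · exact Or.inr ⟨h2, h1⟩
  · rintro (h2 | h2)
    · exact ⟨h2.le, Or.inl h2⟩
    · exact ⟨h2.2, Or.inr h2.1⟩

/-- The initial state satisfies the invariant of the extension phase. -/
theorem IsArborescence.extendInv_initState (hG : G.IsArborescence par depth dist) (hα : 0 < α) :
    G.ExtendInv α par dist depth G.initState := by
  classical
  have htree : ∀ v, G.initState.tree v ≠ none ↔ v = G.source := by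
    intro v; simp [initState]
  have htree' : ∀ v t, G.initState.tree v = some t → v = G.source ∧ t = ⟨none, 0, 0, 0⟩ := by
    intro v t h
    simp only [initState] at h
    split_ifs at h with h1
    exact ⟨h1, (Option.some.inj h).symm⟩
  refine { not_halted := id, edges := rfl, toRewire := rfl, qRewire := rfl,
           source := ?_, node := ?_, key := ?_, par_mem := ?_, qUpdate := rfl, budget := ?_,
           budget_le := ?_, head_mem := ?_, par_notMem := ?_, extended := ?_, qExtend := ?_,
           qFrontier := ?_ }
  · simp [initState]
  · intro v t hv h
    exact absurd (htree' v t h).1 hv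
  · intro v t h
    obtain ⟨rfl, rfl⟩ := htree' v t h
    simp [hG.dist_source]
  · intro v hv h
    exact absurd ((htree v).1 h) hv
  · intro v t h
    obtain ⟨rfl, rfl⟩ := htree' v t h
    simp [hG.depth_source]
  · intro v h
    rw [(htree v).1 h, hG.depth_source]
    exact hα.le
  · intro v h
    rw [htree]
    by_contra hv
    have := hG.depth_par v hv
    omega
  · intro v hv h
    exact absurd ((htree v).1 h) hv
  · intro v hv h h1
    exact absurd ((htree _).1 h) h1
  · intro v hv
    have : v = G.source := hv
    rw [htree, this, hG.depth_source]
    exact ⟨rfl, hα⟩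
  · intro v
    rw [htree]
    have : v ∉ G.initState.qFrontier := Set.notMem_empty v
    simp only [this, false_iff, not_and, not_or]
    rintro rfl
    rw [hG.depth_source]
    exact ⟨hα.ne, fun h => absurd h G.source_ne_target⟩

/-! ### The update phase -/

/-- The budgets `bud` after a first evaluation that touches the path to every vertex but the
target, which is a successor of the source. -/
structure IsAdvance (G : LazyProblem V) (α : ℕ) (par : V → V) (depth bud : V → ℕ) : Prop
    extends G.IsBudget par bud where
  depth_le : ∀ v, bud v = 0 → depth v ≤ α
  lt_depth : ∀ v, v ≠ G.source → v ≠ G.target → bud v < depth v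
  par_target : par G.target = G.source

/-- A wrong budget can only occur at a child of a queued vertex: treating a vertex corrects its
children and queues them in turn. Vertices leave the queue in the order of their distances, which
makes the upper set of distances spanned by the queue a decreasing measure. -/
theorem UpdateInv.updateStep (hG : G.IsArborescence par depth dist)
    (hb : G.IsAdvance α par depth bud) (R : PopRule V) (h : G.UpdateInv α par depth dist bud s)
    (hs : s.qUpdate.Nonempty) :
    G.UpdateInv α par depth dist bud (G.updateStep R α s) ∧
      (G.updateStep R α s).evaluated = s.evaluated ∧
      {v | ∃ q ∈ (G.updateStep R α s).qUpdate, dist q ≤ dist v} ⊂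
        {v | ∃ q ∈ s.qUpdate, dist q ≤ dist v} := by
  classical
  set u := R.pick s.qUpdate fun x => nodeKey (s.tree x) with hu
  have huq : u ∈ s.qUpdate := R.pick_mem _ _ hs
  obtain ⟨hut, hus, huT⟩ := h.mem_queue u (Or.inr huq)
  obtain ⟨t, ht⟩ := Option.ne_none_iff_exists'.1 hut
  -- Keys are distances and distances are injective, so the minimum is strict whatever the
  -- tie-breaking rule.
  have hmin : ∀ x ∈ s.qUpdate, x ≠ u → dist u < dist x := by
    intro x hx hxu
    have h1 := R.pick_le s.qUpdate (fun x => nodeKey (s.tree x)) x hx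
    rw [← hu, h.nodeKey_eq hut, h.nodeKey_eq (h.mem_queue x (Or.inr hx)).1] at h1
    exact lt_of_le_of_ne (WithTop.coe_le_coe.1 h1) fun hc => hxu (hG.dist_injective hc).symm
  have hlt : ∀ Q : Set V, (∀ x ∈ Q, dist u < dist x) →
      {v | ∃ q ∈ Q, dist q ≤ dist v} ⊂ {v | ∃ q ∈ s.qUpdate, dist q ≤ dist v} := by
    intro Q hQ
    refine ⟨?_, fun hc => ?_⟩
    · rintro v ⟨q, hq, hqv⟩
      exact ⟨u, huq, (hQ q hq).le.trans hqv⟩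
    · obtain ⟨q, hq, hqu⟩ := hc (⟨u, huq, le_rfl⟩ : u ∈ {v | ∃ q ∈ s.qUpdate, dist q ≤ dist v})
      exact absurd hqu (hQ q hq).not_ge
  by_cases hch : ∃ v, s.IsChild u v
  · set ch : Set V := {v | v ≠ G.source ∧ u = par v ∧ s.tree v ≠ none ∧ bud v ≠ 0} with hchdef
    have hch' : {v | ∃ t', s.tree v = some t' ∧ t'.parent = some u ∧ 0 < t'.b ∧
        v ∉ s.toRewire} = ch := by
      ext v
      constructor
      · rintro ⟨t', h1, h2, h3, -⟩
        obtain ⟨h4, h5, h6⟩ := (h.isChild_iff u v).1 ⟨t', h1, h2⟩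
        exact ⟨h4, h5, h6, fun hc => h3.ne' ((h.head v t' h1).2 hc)⟩
      · rintro ⟨h1, h2, h3, h4⟩
        obtain ⟨t', ht'⟩ := Option.ne_none_iff_exists'.1 h3
        refine ⟨t', ht', h2 ▸ h.node v t' h1 ht', Nat.pos_of_ne_zero fun hc => ?_, by simp [h.toRewire]⟩
        exact h4 ((h.head v t' ht').1 hc)
    have e : G.updateStep R α s =
        { s with
          tree := fun v => if v ∈ ch then some (G.childNode u t v) else s.tree v
          qFrontier := s.qFrontier \ {v | v ∈ ch ∧ ∃ t', s.tree v = some t' ∧ t'.b = α}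
          qUpdate := (s.qUpdate \ {u}) ∪ ch } := by
      simp only [LazyProblem.updateStep, ← hu, ht, if_pos hch, hch']
    have huch : u ∉ ch := fun hm => hG.par_ne hm.1 hm.2.1.symm
    -- The parent of the target is the source, which is never queued.
    have hTch : G.target ∉ ch := fun hm => hus (hm.2.1.trans hb.par_target)
    have htree : ∀ x, (if x ∈ ch then some (G.childNode u t x) else s.tree x) = none ↔
        s.tree x = none := by
      intro x
      split_ifs with hx
      · simp [hx.2.2.1]
      · rfl
    rw [e]
    refine ⟨{ not_halted := h.not_halted, edges := h.edges, toRewire := h.toRewire,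
              qRewire := h.qRewire, source := ?_, node := ?_, key := ?_, par_mem := ?_,
              mem_iff := ?_, head := ?_, local_budget := ?_, queued := ?_, mem_queue := ?_,
              childless := ?_, target_mem := ?_, qFrontier := ?_ }, rfl, ?_⟩
    · simp [hchdef, h.source]
    · intro v t' hv htv
      dsimp only at htv
      split_ifs at htv with hx
      · cases htv; simp [childNode, hx.2.1]
      · exact h.node v t' hv htv
    · intro v t' htv
      dsimp only at htv
      split_ifs at htv with hx
      · cases htv
        rw [hG.dist_par v hx.1, ← hx.2.1, ← h.key u t ht]
        simp [childNode, add_assoc]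
      · exact h.key v t' htv
    · intro v hv
      simp only [ne_eq, htree]
      exact h.par_mem v hv
    · intro v
      simp only [ne_eq, htree]
      exact h.mem_iff v
    · intro v t' htv
      dsimp only at htv
      split_ifs at htv with hx
      · cases htv
        simp [childNode, hx.2.2.2]
      · exact h.head v t' htv
    · intro v t' htv hbv
      have hvs : v ≠ G.source := by rintro rfl; exact hbv hb.source
      dsimp only at htv ⊢
      by_cases hp : par v ∈ ch
      · exact Or.inl (Or.inr hp)
      rw [if_neg hp]
      split_ifs at htv with hx
      · cases htv
        refine Or.inr ⟨t, hx.2.1 ▸ ht, rfl⟩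
      -- A queued parent of `v` stays queued: if it were `u`, then `v` would belong to `ch`.
      · rcases h.local_budget v t' htv hbv with h1 | h1
        · refine Or.inl (Or.inl ⟨h1, fun h2 => hx ⟨hvs, ?_, by simp [htv], hbv⟩⟩)
          exact (Set.mem_singleton_iff.1 h2).symm
        · exact Or.inr h1
    · intro v t' htv hv
      dsimp only at htv ⊢
      split_ifs at htv with hx
      · exact Or.inr (Or.inl (Or.inr hx))
      · rcases h.queued v t' htv hv with h1 | h1 | h1
        · exact Or.inl h1
        · refine Or.inr (Or.inl (Or.inl ⟨h1, ?_⟩))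
          -- A tree vertex of depth `α` has no child in the tree, so it cannot be the vertex `u`
          -- treated here.
          rintro rfl
          obtain ⟨v, hv'⟩ := hch
          obtain ⟨h2, h3, h4⟩ := (h.isChild_iff _ _).1 hv'
          have h5 := hG.depth_par v h2
          rw [h.mem_iff, h5, ← h3, hv] at h4
          omega
        · exact Or.inr (Or.inr h1)
    · intro v
      simp only [ne_eq, htree]
      rintro (h1 | h1 | h1)
      · exact h.mem_queue v (Or.inl h1)
      · exact h.mem_queue v (Or.inr h1.1)
      · exact ⟨h1.2.2.1, h1.1, fun hc => hTch (hc ▸ h1)⟩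
    · intro v hv
      simp only [ne_eq, htree]
      exact h.childless v hv
    · exact ⟨h.target_mem, fun hc => hTch hc.1⟩
    · rintro v ⟨h1, h2⟩
      rcases h.qFrontier v h1 with h3 | ⟨t', h3, h4⟩
      · exact Or.inl h3
      · refine Or.inr ⟨t', ?_, h4⟩
        dsimp only
        rw [if_neg fun hx => h2 ⟨hx, t', h3, h4⟩, h3]
    · refine hlt _ ?_
      rintro x (hx | hx)
      · exact hmin x hx.1 hx.2
      · rw [hx.2.1]
        exact hG.dist_par_lt hx.1
  · have e : G.updateStep R α s =
        { s with qUpdate := s.qUpdate \ {u}, qExtend := insert u s.qExtend } := by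
      simp only [LazyProblem.updateStep, ← hu, ht, if_neg hch]
    have hnc : ∀ v, v ≠ G.source → s.tree v ≠ none → par v ≠ u := fun v hv htv hc =>
      hch ⟨v, (h.isChild_iff u v).2 ⟨hv, hc.symm, htv⟩⟩
    rw [e]
    refine ⟨{ not_halted := h.not_halted, edges := h.edges, toRewire := h.toRewire,
              qRewire := h.qRewire, source := h.source, node := h.node, key := h.key,
              par_mem := h.par_mem,
              mem_iff := h.mem_iff, head := h.head, local_budget := ?_, queued := ?_,
              mem_queue := ?_, childless := ?_, target_mem := h.target_mem,
              qFrontier := h.qFrontier }, rfl, hlt _ fun x hx => hmin x hx.1 hx.2⟩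
    · intro v t' htv hbv
      change s.tree v = some t' at htv
      have hvs : v ≠ G.source := by rintro rfl; exact hbv hb.source
      rcases h.local_budget v t' htv hbv with h1 | h1
      · exact Or.inl ⟨h1, hnc v hvs (by simp [htv])⟩
      · exact Or.inr h1
    · intro v t' htv hv
      by_cases hvu : v = u
      · exact Or.inl (Or.inl hvu)
      · rcases h.queued v t' htv hv with h1 | h1 | h1
        · exact Or.inl (Or.inr h1)
        · exact Or.inr (Or.inl ⟨h1, hvu⟩)
        · exact Or.inr (Or.inr h1)
    · rintro v ((rfl | h1) | h1)
      · exact ⟨hut, hus, huT⟩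
      · exact h.mem_queue v (Or.inl h1)
      · exact h.mem_queue v (Or.inr h1.1)
    · rintro v hv htv (h1 | h1)
      · exact hnc v hv htv h1
      · exact h.childless v hv htv h1

/-- At the end of the update phase the extension phase can start. -/
theorem UpdateInv.extendInv (hG : G.IsArborescence par depth dist) (hα : 0 < α)
    (hb : G.IsAdvance α par depth bud) (h : G.UpdateInv α par depth dist bud s)
    (hs : s.qUpdate = ∅) : G.ExtendInv α par dist bud s := by
  have hTd : depth G.target = 1 := by
    rw [hG.depth_par _ G.source_ne_target.symm, hb.par_target, hG.depth_source]
  have hle : ∀ v, bud v ≤ depth v := by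
    intro v
    by_cases h1 : v = G.source
    · rw [h1, hb.source]; omega
    by_cases h2 : v = G.target
    · by_cases h3 : bud v = 0
      · omega
      · have := hb.succ v h3
        rw [h2, hb.par_target, hb.source] at this
        rw [h2]
        omega
    · exact (hb.lt_depth v h1 h2).le
  have hbud : ∀ v t, s.tree v = some t → t.b = bud v := by
    -- With an empty queue every budget is correct relative to the parent, so induction from the
    -- head downwards makes it correct absolutely.
    intro v
    induction hn : bud v generalizing v with
    | zero => exact fun t ht => (h.head v t ht).2 hn
    | succ n ih =>
      intro t ht
      have h1 := hb.succ v (by omega)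
      rcases h.local_budget v t ht (by omega) with h2 | ⟨t', h2, h3⟩
      · simp [hs] at h2
      · rw [h3, ih (par v) (by omega) t' h2]
  refine { toTreeInv := h.toTreeInv, qUpdate := hs, budget := hbud, budget_le := ?_, head_mem := ?_,
           par_notMem := h.childless, extended := ?_, qExtend := ?_, qFrontier := ?_ }
  · intro v hv
    exact (hle v).trans ((h.mem_iff v).1 hv)
  · intro v hv
    exact (h.mem_iff v).2 (hb.depth_le v hv)
  · intro v hv h1 h2 h3
    rw [h.mem_iff, hG.depth_par v hv]
    have h4 := (h.mem_iff _).1 h1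
    obtain ⟨t, ht⟩ := Option.ne_none_iff_exists'.1 h1
    rcases h4.lt_or_eq with h5 | h5
    · exact h5
    · rcases h.queued _ t ht h5 with h6 | h6 | h6
      · exact absurd h6 h2
      · simp [hs] at h6
      · rw [hbud _ t ht] at h6
        omega
  · intro v hv
    obtain ⟨h1, h2, h3⟩ := h.mem_queue v (Or.inl hv)
    exact ⟨h1, (hb.lt_depth v h2 h3).trans_le ((h.mem_iff v).1 h1)⟩
  · intro v
    constructor
    · intro hv
      rcases h.qFrontier v hv with rfl | ⟨t, ht, hbt⟩
      · refine ⟨(h.mem_iff _).2 (by omega), Or.inr ⟨rfl, fun hc => ?_⟩⟩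
        exact (h.mem_queue _ (Or.inl hc)).2.2 rfl
      · exact ⟨by simp [ht], Or.inl ((hbud v t ht).symm.trans hbt)⟩
    · rintro ⟨h1, h2⟩
      -- Apart from the source and the target, a tree vertex has budget less than its depth, hence
      -- less than `α`; the source has budget `0`.
      suffices v = G.target by rw [this]; exact h.target_mem
      rcases h2 with h2 | h2
      · by_contra hc
        have h3 : v ≠ G.source := by
          rintro rfl
          rw [hb.source] at h2
          omega
        have := hb.lt_depth v h3 hc
        have := (h.mem_iff v).1 h1
        omega
      · exact h2.1

/-- The update phase and the following extension phase terminate. -/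
theorem UpdateInv.exists_iterate [Finite V] (hG : G.IsArborescence par depth dist) (hα : 0 < α)
    (hb : G.IsAdvance α par depth bud) (R : PopRule V)
    (h : G.UpdateInv α par depth dist bud s) :
    ∃ n, G.ExtendInv α par dist bud ((G.lraStep R α β)^[n] s) ∧
      ((G.lraStep R α β)^[n] s).qExtend = ∅ ∧
      ((G.lraStep R α β)^[n] s).evaluated = s.evaluated := by
  induction hp : {v | ∃ q ∈ s.qUpdate, dist q ≤ dist v}.ncard
    using Nat.strong_induction_on generalizing s with
  | _ m ih =>
    rcases s.qUpdate.eq_empty_or_nonempty with h0 | h0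
    · exact (h.extendInv hG hα hb h0).exists_iterate hG hb.toIsBudget R
    · obtain ⟨h1, h2, h3⟩ := h.updateStep hG hb R h0
      obtain ⟨n, h4, h5, h6⟩ := ih _ (hp ▸ Set.ncard_lt_ncard h3 (Set.toFinite _)) h1 rfl
      refine ⟨n + 1, ?_⟩
      have e : G.lraStep R α β s = G.updateStep R α s := by simp [lraStep, h.not_halted, h0]
      rw [Function.iterate_succ_apply, e]
      exact ⟨h4, h5, h6.trans h2⟩

/-! ### Growth of the set of evaluated edges -/

theorem evaluated_subset_evaluatePath (n : ℕ) (p : List V) (s : LRAState V) :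
    s.evaluated ⊆ (G.evaluatePath n p s).evaluated := by
  classical
  induction n generalizing p s with
  | zero => simp [evaluatePath]
  | succ n ih =>
    match p with
    | [] => simp [evaluatePath]
    | [u] => simp [evaluatePath]
    | u :: v :: p =>
      simp only [evaluatePath]
      split_ifs
      · exact Set.subset_insert _ _
      · refine fun e he => ih _ _ ?_
        exact Set.mem_insert_of_mem _ he
      · exact Set.subset_insert _ _

theorem evaluated_subset_lraStep (R : PopRule V) (s : LRAState V) :
    s.evaluated ⊆ (G.lraStep R α β s).evaluated := by
  classical
  unfold lraStep
  split_ifs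
  · rfl
  · unfold updateStep
    dsimp only
    split
    · rfl
    · split_ifs <;> rfl
  · rfl
  · unfold rewireStep
    dsimp only
    split
    · rfl
    · split_ifs <;> rfl
  · unfold extendStep
    dsimp only
    split
    · rfl
    · split_ifs <;> rfl
  · refine fun e he => ?_
    unfold searchStep
    apply evaluated_subset_evaluatePath
    exact he
  · rfl

theorem monotone_evaluated (R : PopRule V) (s : LRAState V) :
    Monotone fun n => ((G.lraStep R α β)^[n] s).evaluated :=
  monotone_nat_of_le_succ fun n => by
    rw [Function.iterate_succ_apply']
    exact evaluated_subset_lraStep R _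

/-- If the algorithm has halted, then all edges it evaluates have been evaluated. -/
theorem evaluatedEdges_eq_of_halted {R : PopRule V} {n : ℕ}
    (h : ((G.lraStep R α β)^[n] G.initState).halted) :
    G.evaluatedEdges R α β = ((G.lraStep R α β)^[n] G.initState).evaluated := by
  have hfix : G.lraStep R α β ((G.lraStep R α β)^[n] G.initState) =
      (G.lraStep R α β)^[n] G.initState := by
    rw [lraStep, if_pos h]
  ext e
  refine ⟨?_, fun he => ⟨n, he⟩⟩
  rintro ⟨m, hm⟩
  have h1 := monotone_evaluated (G := G) (α := α) (β := β) R G.initState (Nat.le_add_right m n) hm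
  dsimp only at h1
  rwa [Function.iterate_add_apply, Function.iterate_fixed hfix] at h1

/-- The first edges of a collision-free path that avoids the target are evaluated. -/
theorem mem_evaluated_evaluatePath {u v w : V} {p : List V} (h2 : 1 < β)
    (h1 : G.w u v = (G.lazyW u v : WithTop ℝ)) (hv : v ≠ G.target) :
    (v, w) ∈ (G.evaluatePath β (u :: v :: w :: p) s).evaluated := by
  classical
  obtain ⟨n, rfl⟩ : ∃ n, β = n + 2 := ⟨β - 2, by omega⟩
  rw [evaluatePath, if_pos h1]
  dsimp only
  rw [if_neg hv, evaluatePath]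
  split_ifs
  · exact Set.mem_insert _ _
  · exact evaluated_subset_evaluatePath _ _ _ (Set.mem_insert _ _)
  · exact Set.mem_insert _ _

/-! ### Evaluation along a path -/

theorem TreeInv.tail_succ (h : G.TreeInv par dist s) {v : V} (hv : v ≠ G.source)
    (ht : s.tree v ≠ none) (n : ℕ) : s.tail (n + 1) v = s.tail n (par v) ++ [v] := by
  obtain ⟨t, ht⟩ := Option.ne_none_iff_exists'.1 ht
  have : (s.tree v).bind TreeNode.parent = some (par v) := by
    rw [ht]; exact h.node v t hv ht
  rw [LRAState.tail, this]

/-- The vertices `a 0, …, a α` form a path that starts in the source and avoids the target. -/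
structure IsSpine (G : LazyProblem V) (α : ℕ) (par : V → V) (a : ℕ → V) : Prop where
  zero : a 0 = G.source
  succ_ne_source : ∀ i < α, a (i + 1) ≠ G.source
  succ_ne_target : ∀ i < α, a (i + 1) ≠ G.target
  par_succ : ∀ i < α, par (a (i + 1)) = a i

variable {a : ℕ → V}

theorem IsSpine.depth_eq (ha : G.IsSpine α par a) (hG : G.IsArborescence par depth dist)
    {i : ℕ} (hi : i ≤ α) : depth (a i) = i := by
  induction i with
  | zero => rw [ha.zero, hG.depth_source]
  | succ i ih =>
    rw [hG.depth_par _ (ha.succ_ne_source i hi), ha.par_succ i hi, ih (by omega)]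

theorem TreeInv.tail_spine (h : G.TreeInv par dist s) (ha : G.IsSpine α par a) {m n : ℕ}
    (hmn : m + n ≤ α) (ht : ∀ i ≤ α, s.tree (a i) ≠ none) :
    s.tail n (a (m + n)) = (List.range' m (n + 1)).map a := by
  induction n with
  | zero => simp [LRAState.tail]
  | succ n ih =>
    rw [← add_assoc, h.tail_succ (ha.succ_ne_source _ (by omega)) (ht _ (by omega)),
      ha.par_succ _ (by omega), ih (by omega), List.range'_1_concat (n := n + 1)]
    simp [add_assoc]

open Classical in
-- No edge is in collision and no vertex of the spine after its start is the target, so the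
-- evaluation runs through all `n` edges. The hypothesis `hc` makes the accumulated true costs equal
-- to the distances.
theorem IsSpine.evaluatePath_eq (ha : G.IsSpine α par a)
    (hG : G.IsArborescence par depth dist) {m n k : ℕ} (hnk : n ≤ k) (hk : m + k ≤ α)
    (hc : ((s.tree (a m)).map TreeNode.c).getD 0 = dist (a m)) :
    G.evaluatePath n ((List.range' m (k + 1)).map a) s =
      { s with
        tree := fun x => if ∃ i, m < i ∧ i ≤ m + n ∧ x = a i then
          some ⟨some (par x), dist x, 0, 0⟩ else s.tree x
        qUpdate := s.qUpdate ∪ {x | ∃ i, m < i ∧ i ≤ m + n ∧ x = a i}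
        evaluated := s.evaluated ∪ {e | ∃ i, m < i ∧ i ≤ m + n ∧ e = (par (a i), a i)} } := by
  induction n generalizing m k s with
  | zero =>
    have h0 : ∀ P : ℕ → Prop, ¬ ∃ i, m < i ∧ i ≤ m + 0 ∧ P i := by
      rintro P ⟨i, h1, h2, -⟩
      omega
    simp only [evaluatePath, h0, if_false, Set.ofPred_false, Set.union_empty]
  | succ n ih =>
    obtain ⟨k, rfl⟩ : ∃ k', k = k' + 1 := ⟨k - 1, by omega⟩
    have hs := ha.succ_ne_source m (by omega)
    have hp := ha.par_succ m (by omega)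
    have hadj : G.adj (a m) (a (m + 1)) := (hG.adj_iff _ _).2 ⟨hs, hp.symm⟩
    have hd : dist (a m) + G.lazyW (a m) (a (m + 1)) = dist (a (m + 1)) := by
      rw [hG.dist_par _ hs, hp]
    have hsplit : ∀ P : ℕ → Prop, (∃ i, m < i ∧ i ≤ m + (n + 1) ∧ P i) ↔
        P (m + 1) ∨ ∃ i, m + 1 < i ∧ i ≤ m + 1 + n ∧ P i := by
      intro P
      constructor
      · rintro ⟨i, h1, h2, h3⟩
        rcases (Nat.succ_le_of_lt h1).eq_or_lt with h4 | h4
        · subst h4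
          exact Or.inl h3
        · exact Or.inr ⟨i, h4, by omega, h3⟩
      · rintro (h | ⟨i, h1, h2, h3⟩)
        · exact ⟨m + 1, by omega, by omega, h⟩
        · exact ⟨i, by omega, by omega, h3⟩
    have e : (List.range' m (k + 1 + 1)).map a =
        a m :: a (m + 1) :: (List.range' (m + 2) k).map a := by
      simp [List.range'_succ]
    have e' : a (m + 1) :: (List.range' (m + 2) k).map a =
        (List.range' (m + 1) (k + 1)).map a := by
      simp [List.range'_succ]
    rw [e, evaluatePath, if_pos (hG.free _ _ hadj)]
    dsimp only
    rw [if_neg (ha.succ_ne_target m (by omega)), hc, hd, e', ih (by omega) (by omega) (by simp)]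
    simp only [hsplit]
    congr 1
    · funext x
      by_cases h1 : x = a (m + 1)
      · subst h1; simp [hp]
      · simp [h1]
    · ext x
      simp only [Set.mem_union, Set.mem_insert_iff, Set.mem_ofPred_eq]
      tauto
    · ext x
      simp only [Set.mem_union, Set.mem_insert_iff, Set.mem_ofPred_eq, hp]
      tauto

theorem ExtendInv.lraStep_eq_evaluatePath {R : PopRule V} (h : G.ExtendInv α par dist bud s)
    (hs : s.qExtend = ∅) {v : V} (hv : s.tree v ≠ none)
    (hpick : R.pick s.qFrontier (fun x => nodeKey (s.tree x)) = v) (hF : s.qFrontier.Nonempty) :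
    G.lraStep R α β s =
      G.evaluatePath β (s.tail (bud v) v) { s with qFrontier := s.qFrontier \ {v} } := by
  obtain ⟨t, ht⟩ := Option.ne_none_iff_exists'.1 hv
  have hbt := h.budget v t ht
  simp [lraStep, h.not_halted, h.qUpdate, h.toRewire, h.qRewire, hs, hF, searchStep, hpick, ht, hbt]

/-- The first search step starts the update phase. -/
theorem ExtendInv.lraStep_spine {R : PopRule V} (hG : G.IsArborescence par depth dist)
    (ha : G.IsSpine α par a) (hb : G.IsAdvance α par depth bud) (hα : 0 < α) (hβ : β ≤ α)
    (hbud : ∀ v, bud v = 0 ↔ ∃ i ≤ β, v = a i)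
    (h : G.ExtendInv α par dist depth s) (hs : s.qExtend = ∅)
    (hpick : R.pick s.qFrontier (fun x => nodeKey (s.tree x)) = a α) :
    G.UpdateInv α par depth dist bud (G.lraStep R α β s) ∧
      (G.lraStep R α β s).evaluated =
        s.evaluated ∪ {e | ∃ i, 0 < i ∧ i ≤ β ∧ e = (par (a i), a i)} := by
  classical
  -- Before the first search only the source is in the head, so the budgets are the depths.
  have hbd : G.IsBudget par depth := by
    refine ⟨hG.depth_source, fun v hv => hG.depth_par v ?_⟩
    rintro rfl
    exact hv hG.depth_source
  have hmem := h.mem_iff hbd hs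
  have hF := h.mem_qFrontier hbd hs
  have hTd : depth G.target = 1 := by
    rw [hG.depth_par _ G.source_ne_target.symm, hb.par_target, hG.depth_source]
  have haα : s.tree (a α) ≠ none := by rw [hmem, ha.depth_eq hG le_rfl]
  have hstep := h.lraStep_eq_evaluatePath (β := β) hs haα hpick
    ⟨a α, (hF _).2 (Or.inl (ha.depth_eq hG le_rfl))⟩
  have htail := h.tail_spine ha (m := 0) (n := α) (by omega) fun i hi => by
    rw [hmem, ha.depth_eq hG hi]; exact hi
  rw [zero_add] at htail
  rw [ha.depth_eq hG le_rfl, htail, ha.evaluatePath_eq hG hβ (by omega)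
    (by simp [ha.zero, h.source, hG.dist_source])] at hstep
  simp only [zero_add, h.qUpdate, Set.empty_union] at hstep
  rw [hstep]
  set S : Set V := {x | ∃ i, 0 < i ∧ i ≤ β ∧ x = a i} with hS
  have hSm : ∀ x, (∃ i, 0 < i ∧ i ≤ β ∧ x = a i) ↔ x ∈ S := fun x => Iff.rfl
  simp only [hSm]
  have hSs : ∀ x ∈ S, x ≠ G.source := by
    rintro x ⟨i, h1, h2, rfl⟩
    obtain ⟨j, rfl⟩ : ∃ j, i = j + 1 := ⟨i - 1, by omega⟩
    exact ha.succ_ne_source j (by omega)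
  have hSt : ∀ x ∈ S, x ≠ G.target := by
    rintro x ⟨i, h1, h2, rfl⟩
    obtain ⟨j, rfl⟩ : ∃ j, i = j + 1 := ⟨i - 1, by omega⟩
    exact ha.succ_ne_target j (by omega)
  have hSd : ∀ x ∈ S, depth x = α → x = a α := by
    rintro x ⟨i, h1, h2, rfl⟩ h3
    rw [ha.depth_eq hG (by omega)] at h3
    rw [h3]
  have hSmem : ∀ x ∈ S, s.tree x ≠ none := by
    rintro x ⟨i, h1, h2, rfl⟩
    rw [hmem, ha.depth_eq hG (by omega)]
    omega
  have hbS : ∀ x, bud x = 0 ↔ x ∈ S ∨ x = G.source := by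
    intro x
    rw [hbud, hS]
    constructor
    · rintro ⟨i, h1, rfl⟩
      rcases Nat.eq_zero_or_pos i with rfl | h2
      · exact Or.inr ha.zero
      · exact Or.inl ⟨i, h2, h1, rfl⟩
    · rintro (⟨i, h2, h1, rfl⟩ | rfl)
      · exact ⟨i, h1, rfl⟩
      · exact ⟨0, Nat.zero_le _, ha.zero.symm⟩
  have htree : ∀ x, (if x ∈ S then some (⟨some (par x), dist x, 0, 0⟩ : TreeNode V)
      else s.tree x) = none ↔ s.tree x = none := by
    intro x
    split_ifs with hx
    · simp [hSmem x hx]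
    · rfl
  have hTF : G.target ∈ s.qFrontier := (hF _).2 (Or.inr ⟨rfl, by omega⟩)
  refine ⟨{ not_halted := h.not_halted, edges := h.edges, toRewire := h.toRewire,
            qRewire := h.qRewire, source := ?_, node := ?_, key := ?_, par_mem := ?_,
            mem_iff := ?_, head := ?_, local_budget := ?_, queued := ?_, mem_queue := ?_,
            childless := ?_, target_mem := ?_, qFrontier := ?_ }, trivial⟩
  · dsimp only
    rw [if_neg fun hx => hSs _ hx rfl, h.source]
  · intro v t hv htv
    dsimp only at htv
    split_ifs at htv with hx
    · cases htv; rfl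
    · exact h.node v t hv htv
  · intro v t htv
    dsimp only at htv
    split_ifs at htv with hx
    · cases htv; simp
    · exact h.key v t htv
  · intro v hv
    simp only [ne_eq, htree]
    exact h.par_mem v hv
  · intro v
    simp only [ne_eq, htree]
    exact hmem v
  · intro v t htv
    dsimp only at htv
    rw [hbS]
    split_ifs at htv with hx
    · cases htv; simp [hx]
    · rw [h.budget v t htv]
      simp only [hx, false_or]
      constructor
      · intro h0
        by_contra hv
        have := hG.depth_par v hv
        omega
      · rintro rfl
        exact hG.depth_source
  · intro v t htv hbv
    rw [Ne, hbS, not_or] at hbv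
    dsimp only at htv ⊢
    rw [if_neg hbv.1] at htv
    by_cases hp : par v ∈ S
    · exact Or.inl hp
    · rw [if_neg hp]
      obtain ⟨t', ht'⟩ := Option.ne_none_iff_exists'.1 (h.par_mem v hbv.2 (by simp [htv]))
      refine Or.inr ⟨t', ht', ?_⟩
      rw [h.budget _ _ htv, h.budget _ _ ht', hG.depth_par v hbv.2]
  · intro v t htv hv
    dsimp only at htv ⊢
    split_ifs at htv with hx
    · exact Or.inr (Or.inl hx)
    · exact Or.inr (Or.inr ((h.budget v t htv).trans hv))
  · intro v
    simp only [ne_eq, htree, hs, Set.mem_empty_iff_false, false_or]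
    exact fun hv => ⟨hSmem v hv, hSs v hv, hSt v hv⟩
  · intro v _ _
    simp [hs]
  · refine ⟨hTF, fun hc => ?_⟩
    obtain ⟨j, rfl⟩ : ∃ j, α = j + 1 := ⟨α - 1, by omega⟩
    exact ha.succ_ne_target j (by omega) (Set.mem_singleton_iff.1 hc).symm
  · rintro v ⟨hv, hva⟩
    rcases (hF v).1 hv with h1 | h1
    · refine Or.inr ?_
      dsimp only
      -- The only evaluated vertex that can have depth `α` is `a α`, which has just left the
      -- frontier; all other frontier nodes are unchanged.
      rw [if_neg fun hx => hva (hSd v hx h1)]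
      obtain ⟨t, ht⟩ := Option.ne_none_iff_exists'.1 ((hmem v).2 h1.le)
      exact ⟨t, ht, (h.budget v t ht).trans h1⟩
    · exact Or.inl h1.1

end LazyProblem

/-! ### The forked tree and its distances -/

namespace ForkedTree

/-- The parent map of the tree on `0, …, 2 * α` that consists of the path `0, …, α`, the branch
`α + 1, …, 2 * α - 1` that leaves this path in the vertex `b + 1`, and the successor `2 * α` of the
root `0`. -/
def parent (α b i : ℕ) : ℕ := if i = α + 1 then b + 1 else if i = 2 * α then 0 else i - 1

/-- The depth of the vertices of the tree. -/
def depth (α b i : ℕ) : ℕ := if i = 2 * α then 1 else if α < i then b + 1 + (i - α) else i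

/-- The budget of the vertices when the first `β` edges of the path have been evaluated. -/
def budget (α b β i : ℕ) : ℕ :=
  if i = 2 * α then 1 else if α < i then b + 1 + (i - α) - min β (b + 1) else i - β

/-- The lazy cost of the path from the root to a vertex if the edge into `i` costs `2 ^ i`. -/
def dist (α b i : ℕ) : ℝ :=
  if i = 2 * α then 2 ^ i else
    if α < i then 2 ^ (b + 2) - 2 + (2 ^ (i + 1) - 2 ^ (α + 1)) else 2 ^ (i + 1) - 2

theorem parent_lt {α b i : ℕ} (hb : b < α) (hi : 0 < i) : parent α b i < i := by
  unfold parent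
  split_ifs <;> omega

/-- The tree as a lazy shortest-path problem without collisions. -/
def problem (α b : ℕ) (hα : 0 < α) : LazyProblem (Fin (2 * α + 1)) where
  adj u v := 0 < v.val ∧ u.val = parent α b v.val
  lazyW _ v := 2 ^ v.val
  w _ v := ((2 ^ v.val : ℝ) : WithTop ℝ)
  source := ⟨0, by omega⟩
  target := ⟨2 * α, by omega⟩
  lazyW_pos _ _ _ := by positivity
  w_eq _ _ _ := Or.inl rfl
  source_ne_target h := by
    have := congrArg Fin.val h
    dsimp only at this
    omega

/-- The parent map on the vertex type. -/
def par (α b : ℕ) (hb : b < α) (v : Fin (2 * α + 1)) : Fin (2 * α + 1) :=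
  ⟨parent α b v.val, by
    have := v.isLt
    unfold parent
    split_ifs <;> omega⟩

/-- The vertices of the path `0, …, α`. -/
def spine (α i : ℕ) : Fin (2 * α + 1) := ⟨min i (2 * α), by omega⟩

/-- The distance is a sum of distinct powers of two, the largest of which is `2 ^ i`. These dyadic
intervals do not overlap, which gives the monotonicity of `dist`. -/
theorem dist_bounds {α b i : ℕ} (hb : b < α) (hi : 0 < i) :
    (2 : ℝ) ^ i ≤ dist α b i ∧ dist α b i < 2 ^ (i + 1) := by
  have hpos : (0 : ℝ) < 2 ^ i := by positivity
  unfold dist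
  split_ifs with h1 h2
  · rw [pow_succ]
    constructor <;> linarith
  · have h3 : (2 : ℝ) ^ (α + 1) ≤ 2 ^ i := pow_le_pow_right₀ one_le_two h2
    have h4 : (2 : ℝ) ^ (b + 2) ≤ 2 ^ (α + 1) := pow_le_pow_right₀ one_le_two (by omega)
    have h5 : (2 : ℝ) ^ 1 ≤ 2 ^ (b + 2) := pow_le_pow_right₀ one_le_two (by omega)
    rw [pow_succ _ i]
    constructor <;> linarith
  · have h3 : (2 : ℝ) ^ 1 ≤ 2 ^ i := pow_le_pow_right₀ one_le_two hi
    rw [pow_succ]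
    constructor <;> linarith

theorem dist_lt {α b i j : ℕ} (hb : b < α) (hij : i < j) : dist α b i < dist α b j := by
  have hj := (dist_bounds hb (pos_of_gt hij)).1
  rcases Nat.eq_zero_or_pos i with rfl | hi
  · have h0 : dist α b 0 = 0 := by
      unfold dist
      rw [if_neg (by omega), if_neg (by omega)]
      norm_num
    rw [h0]
    exact lt_of_lt_of_le (by positivity) hj
  · exact ((dist_bounds hb hi).2.trans_le (pow_le_pow_right₀ one_le_two hij)).trans_le hj

theorem dist_strictMono {α b : ℕ} (hb : b < α) : StrictMono (dist α b) := fun _ _ => dist_lt hb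

theorem dist_parent {α b i : ℕ} (hb : 0 < b) (hbα : b < α) (hi : 0 < i) (hi' : i ≤ 2 * α) :
    dist α b i = dist α b (parent α b i) + 2 ^ i := by
  unfold parent
  split_ifs with h1 h2
  · subst h1
    unfold dist
    rw [if_neg (by omega), if_pos (by omega), if_neg (by omega), if_neg (by omega)]
    ring
  · subst h2
    unfold dist
    rw [if_pos rfl, if_neg (by omega), if_neg (by omega)]
    norm_num
  · obtain ⟨j, rfl⟩ : ∃ j, i = j + 1 := ⟨i - 1, by omega⟩
    unfold dist
    rw [Nat.add_sub_cancel, if_neg h2]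
    by_cases h3 : α < j
    · rw [if_pos (by omega), if_neg (by omega), if_pos h3]
      ring
    · rw [if_neg (by omega), if_neg (by omega), if_neg (by omega)]
      ring

variable {α b β : ℕ}

theorem isArborescence (hb : 0 < b) (hbα : b < α) (hα : 0 < α) :
    (problem α b hα).IsArborescence (par α b hbα) (fun v => depth α b v.val)
      (fun v => dist α b v.val) := by
  have hs : ∀ v : Fin (2 * α + 1), v ≠ (problem α b hα).source ↔ 0 < v.val := by
    intro v
    rw [Ne, Fin.ext_iff]
    exact Nat.pos_iff_ne_zero.symm
  constructor
  · intro u v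
    rw [hs, Fin.ext_iff]
    rfl
  · intro u v _
    rfl
  · change depth α b 0 = 0
    unfold depth
    split_ifs <;> omega
  · intro v hv
    rw [hs] at hv
    have := v.isLt
    change depth α b v.val = depth α b (parent α b v.val) + 1
    unfold depth parent
    split_ifs <;> omega
  · change dist α b 0 = 0
    unfold dist
    rw [if_neg (by omega), if_neg (by omega)]
    norm_num
  · intro v hv
    exact dist_parent hb hbα ((hs v).1 hv) (Nat.le_of_lt_succ v.isLt)
  · intro v hv h
    rw [hs] at hv
    have h1 := v.isLt
    have h2 : parent α b v.val = 2 * α := congrArg Fin.val h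
    have := parent_lt hbα hv
    omega
  · intro u v huv
    exact Fin.ext ((dist_strictMono hbα).injective huv)

/-- Since the branch leaves the path behind its first edge, that edge lies on the way to every
vertex except the source and the target. Evaluating it therefore lowers all their budgets. -/
theorem isAdvance (hb : 0 < b) (hbα : b < α) (hα : 0 < α) (hβ : 0 < β) (hβα : β ≤ α) :
    (problem α b hα).IsAdvance α (par α b hbα) (fun v => depth α b v.val)
      (fun v => budget α b β v.val) := by
  refine ⟨⟨?_, ?_⟩, ?_, ?_, ?_⟩
  · change budget α b β 0 = 0
    unfold budget
    split_ifs <;> omega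
  · intro v hv
    have := v.isLt
    change budget α b β v.val = budget α b β (parent α b v.val) + 1
    change budget α b β v.val ≠ 0 at hv
    unfold budget parent at *
    split_ifs at * <;> omega
  · intro v hv
    have := v.isLt
    unfold budget depth at *
    split_ifs at * <;> omega
  · intro v h0 h1
    have h0' : v.val ≠ 0 := fun h => h0 (Fin.ext h)
    have h1' : v.val ≠ 2 * α := fun h => h1 (Fin.ext h)
    unfold budget depth
    split_ifs <;> omega
  · refine Fin.ext ?_
    change parent α b (2 * α) = 0
    unfold parent
    split_ifs <;> omega

theorem budget_eq_zero_iff (hα : 0 < α) (hβα : β ≤ α) (v : Fin (2 * α + 1)) :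
    budget α b β v.val = 0 ↔ ∃ i ≤ β, v = spine α i := by
  have := v.isLt
  constructor
  · intro h
    refine ⟨v.val, ?_, Fin.ext ?_⟩
    · unfold budget at h
      split_ifs at h <;> omega
    · simp only [spine]
      omega
  · rintro ⟨i, hi, rfl⟩
    change budget α b β (min i (2 * α)) = 0
    unfold budget
    split_ifs <;> omega

theorem isSpine (hbα : b < α) (hα : 0 < α) :
    (problem α b hα).IsSpine α (par α b hbα) (spine α) := by
  -- The truncation in `spine` only keeps the number in range and has no effect for indices up to
  -- `α`.
  have h1 : ∀ i < α, (spine α (i + 1)).val = i + 1 := by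
    intro i hi
    simp only [spine]
    omega
  refine ⟨Fin.ext ?_, fun i hi h => ?_, fun i hi h => ?_, fun i hi => Fin.ext ?_⟩
  · change min 0 (2 * α) = 0
    omega
  · have h2 : (spine α (i + 1)).val = 0 := congrArg Fin.val h
    rw [h1 i hi] at h2
    omega
  · have h2 : (spine α (i + 1)).val = 2 * α := congrArg Fin.val h
    rw [h1 i hi] at h2
    omega
  · change parent α b (spine α (i + 1)).val = min i (2 * α)
    rw [h1 i hi]
    unfold parent
    split_ifs <;> omega

/-! ### Distinct path costs by binary expansion -/

/-- Paths in the tree are determined by their lazy cost. -/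
theorem distinctPathCosts (hbα : b < α) (hα : 0 < α) : (problem α b hα).DistinctPathCosts := by
  set G := problem α b hα
  have hcost : ∀ u (p : List (Fin (2 * α + 1))),
      G.lazyCost (u :: p) = (p.map fun v => (2 : ℝ) ^ v.val).sum := by
    intro u p
    induction p generalizing u with
    | nil => simp [LazyProblem.lazyCost]
    | cons v p ih =>
      have := ih v
      simp only [LazyProblem.lazyCost, List.tail_cons, List.zip_cons_cons, List.map_cons,
        List.sum_cons] at this ⊢
      rw [this]
      rfl
  -- Numbers increase along edges, so a path uses each power of two at most once.
  have hchain : ∀ p : List (Fin (2 * α + 1)), p.IsChain G.adj → p.SortedLT := by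
    intro p hp
    refine (List.IsChain.imp (fun u v h => ?_) hp).sortedLT
    have h1 : 0 < v.val ∧ u.val = parent α b v.val := h
    rw [Fin.lt_def, h1.2]
    exact parent_lt hbα h1.1
  have hsum : ∀ p q : List (Fin (2 * α + 1)), p.SortedLT → q.SortedLT →
      (p.map fun v => (2 : ℝ) ^ v.val).sum = (q.map fun v => (2 : ℝ) ^ v.val).sum → p = q := by
    intro p q hp hq h
    -- The cost becomes a natural number whose binary digits are indexed by the vertices of the
    -- list.
    have hc : ∀ l : List (Fin (2 * α + 1)), l.SortedLT →
        (l.map fun v => (2 : ℝ) ^ v.val).sum =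
          ((∑ i ∈ (l.map Fin.val).toFinset, 2 ^ i : ℕ) : ℝ) := by
      intro l hl
      rw [List.sum_toFinset _ (hl.nodup.map Fin.val_injective), Nat.cast_list_sum, List.map_map,
        List.map_map]
      simp [Function.comp_def]
    rw [hc p hp, hc q hq, Nat.cast_inj] at h
    have h1 := Finset.geomSum_injective le_rfl h
    refine List.Perm.eq_of_sortedLE hp.sortedLE hq.sortedLE ?_
    rw [List.perm_ext_iff_of_nodup hp.nodup hq.nodup]
    intro x
    have h2 := congrArg (x.val ∈ ·) h1
    simpa [Fin.val_inj] using h2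
  intro p q hp hq hp2 hq2 h
  match p, q with
  | u :: v :: p, u' :: v' :: q =>
    rw [hcost, hcost] at h
    have h1 := hsum _ _ (hchain _ hp.tail) (hchain _ hq.tail) h
    obtain ⟨rfl, rfl⟩ := List.cons.inj h1
    have h2 : 0 < v.val ∧ u.val = parent α b v.val := hp.rel
    have h3 : 0 < v.val ∧ u'.val = parent α b v.val := hq.rel
    -- The first vertex does not contribute to the cost, but it is the parent of the second one.
    rw [Fin.ext (h2.2.trans h3.2.symm)]

/-- The vertex of minimal key among those of a set is the one of smallest number. -/
theorem pick_eq {par' : Fin (2 * α + 1) → Fin (2 * α + 1)} (hbα : b < α) (hα : 0 < α)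
    (R : PopRule (Fin (2 * α + 1)))
    {s : LRAState (Fin (2 * α + 1))}
    (h : (problem α b hα).TreeInv par' (fun v => dist α b v.val) s) {Q : Set (Fin (2 * α + 1))}
    (hQ : ∀ v ∈ Q, s.tree v ≠ none) {x : Fin (2 * α + 1)} (hx : x ∈ Q) (hmin : ∀ v ∈ Q, x ≤ v) :
    R.pick Q (fun v => nodeKey (s.tree v)) = x := by
  have hm := R.pick_mem Q (fun v => nodeKey (s.tree v)) ⟨x, hx⟩
  have hle := R.pick_le Q (fun v => nodeKey (s.tree v)) x hx
  rw [h.nodeKey_eq (hQ _ hm), h.nodeKey_eq (hQ _ hx), WithTop.coe_le_coe] at hle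
  exact le_antisymm ((dist_strictMono hbα).le_iff_le.1 hle) (hmin _ hm)

/-! ### The two search steps on the forked tree -/

/-- The state in which the second search step starts. -/
theorem exists_second_search (hb : 0 < b) (hbα : b < α) (hα : 0 < α) (hβ : 0 < β) (hβα : β ≤ α)
    (R : PopRule (Fin (2 * α + 1))) :
    ∃ n, (problem α b hα).ExtendInv α (par α b hbα) (fun v => dist α b v.val)
        (fun v => budget α b β v.val) (((problem α b hα).lraStep R α β)^[n]
          (problem α b hα).initState) ∧
      (((problem α b hα).lraStep R α β)^[n] (problem α b hα).initState).qExtend = ∅ ∧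
      (((problem α b hα).lraStep R α β)^[n] (problem α b hα).initState).evaluated =
        {e | ∃ i, 0 < i ∧ i ≤ β ∧ e = (par α b hbα (spine α i), spine α i)} := by
  set G := problem α b hα
  have hG := isArborescence hb hbα hα
  have hadv := isAdvance hb hbα hα hβ hβα
  have hbd : G.IsBudget (par α b hbα) (fun v => depth α b v.val) := by
    refine ⟨hG.depth_source, fun v hv => hG.depth_par v ?_⟩
    rintro rfl
    exact hv hG.depth_source
  obtain ⟨n₁, h1, h2, h3⟩ :=
    (hG.extendInv_initState hα).exists_iterate (β := β) hG hbd R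
  set s₁ := (G.lraStep R α β)^[n₁] G.initState
  have hF := h1.mem_qFrontier hbd h2
  have hpick : R.pick s₁.qFrontier (fun x => nodeKey (s₁.tree x)) = spine α α := by
    -- Vertices of depth `α` lie at the end of the path or on the branch, and the branch and the
    -- target have larger numbers than `α`.
    refine pick_eq hbα hα R h1.toTreeInv (fun v hv => ((h1.qFrontier v).1 hv).1) ?_ ?_
    · rw [hF]
      refine Or.inl ?_
      simp only [spine]
      unfold depth
      split_ifs <;> omega
    · intro v hv
      rw [Fin.le_def]
      simp only [spine]
      rcases (hF v).1 hv with h | h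
      · unfold depth at h
        split_ifs at h <;> omega
      · rw [h.1]
        change _ ≤ 2 * α
        omega
  obtain ⟨h4, h5⟩ := h1.lraStep_spine hG (isSpine hbα hα) hadv hα hβα
    (budget_eq_zero_iff hα hβα) h2 hpick
  obtain ⟨n₂, h6, h7, h8⟩ := h4.exists_iterate (β := β) hG hα hadv R
  rw [← Function.iterate_succ_apply, ← Function.iterate_add_apply] at h6 h7 h8
  refine ⟨n₂.succ + n₁, h6, h7, ?_⟩
  rw [h8, h5, h3]
  exact Set.empty_union _

/-- With greediness `b` the first edge of the branch is evaluated. -/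
theorem branch_mem (hb : 1 < b) (hbα : b < α) (hα : 0 < α) (R : PopRule (Fin (2 * α + 1))) :
    ((⟨b + 1, by omega⟩, ⟨α + 1, by omega⟩) : Fin (2 * α + 1) × Fin (2 * α + 1)) ∈
      (problem α b hα).evaluatedEdges R α b := by
  set G := problem α b hα
  have hb0 : 0 < b := by omega
  have hG := isArborescence hb0 hbα hα
  have hadv := isAdvance hb0 hbα hα hb0 hbα.le
  obtain ⟨n, h1, h2, -⟩ := exists_second_search hb0 hbα hα hb0 hbα.le R
  refine ⟨n + 1, ?_⟩
  rw [Function.iterate_succ_apply']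
  set s := (G.lraStep R α b)^[n] G.initState
  have hmem := h1.mem_iff hadv.toIsBudget h2
  have hF := h1.mem_qFrontier hadv.toIsBudget h2
  -- The last vertex of the branch has depth `b + α`; with `b` evaluated edges its budget is exactly
  -- `α`.
  set x : Fin (2 * α + 1) := ⟨2 * α - 1, by omega⟩ with hx
  have hbx : budget α b b x.val = α := by
    simp only [hx]
    unfold budget
    split_ifs <;> omega
  have hxF : x ∈ s.qFrontier := (hF x).2 (Or.inl hbx)
  have hpick : R.pick s.qFrontier (fun v => nodeKey (s.tree v)) = x := by
    refine pick_eq hbα hα R h1.toTreeInv (fun v hv => ((h1.qFrontier v).1 hv).1) hxF ?_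
    intro v hv
    have := v.isLt
    rw [Fin.le_def]
    simp only [hx]
    rcases (hF v).1 hv with h | h
    · unfold budget at h
      split_ifs at h <;> omega
    · rw [h.1]
      change _ ≤ 2 * α
      omega
  rw [h1.lraStep_eq_evaluatePath h2 ((hmem x).2 hbx.le) hpick ⟨x, hxF⟩]
  rw [hbx]
  have hs : ∀ v : Fin (2 * α + 1), 0 < v.val → v ≠ G.source := by
    rintro v hv rfl
    exact lt_irrefl 0 hv
  have hts : ∀ (v u : Fin (2 * α + 1)) (m : ℕ), 0 < v.val → budget α b b v.val ≤ α →
      parent α b v.val = u.val → s.tail (m + 1) v = s.tail m u ++ [v] := by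
    intro v u m h3 h4 h5
    rw [h1.tail_succ (hs v h3) ((hmem v).2 h4), show par α b hbα v = u from Fin.ext h5]
  -- The tail of the branch vertex `α + 1 + i` has `2 + i` edges and starts in the border vertex
  -- `b`; the edge in question is its second one.
  have htail : ∀ (i : ℕ) (hi : α + 1 + i < 2 * α), ∃ l, s.tail (2 + i) ⟨α + 1 + i, by omega⟩ =
      ⟨b, by omega⟩ :: ⟨b + 1, by omega⟩ :: ⟨α + 1, by omega⟩ :: l := by
    intro i
    induction i with
    | zero =>
      intro hi
      refine ⟨[], ?_⟩
      rw [hts _ ⟨b + 1, by omega⟩ 1 (by simp), hts _ ⟨b, by omega⟩ 0 (by simp)]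
      · rfl
      all_goals
        simp only [budget, parent]
        split_ifs <;> omega
    | succ i ih =>
      intro hi
      obtain ⟨l, hl⟩ := ih (by omega)
      refine ⟨l ++ [⟨α + 1 + (i + 1), by omega⟩], ?_⟩
      rw [← add_assoc 2, hts _ ⟨α + 1 + i, by omega⟩ (2 + i) (by simp), hl]
      · rfl
      all_goals
        simp only [budget, parent]
        split_ifs <;> omega
  obtain ⟨l, hl⟩ := htail (α - 2) (by omega)
  have hx' : (⟨α + 1 + (α - 2), by omega⟩ : Fin (2 * α + 1)) = x := Fin.ext (by simp only [hx]; omega)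
  rw [hx', show 2 + (α - 2) = α by omega] at hl
  rw [show s.tail α x = _ from hl]
  refine LazyProblem.mem_evaluated_evaluatePath hb rfl fun h => ?_
  have : b + 1 = 2 * α := congrArg Fin.val h
  omega

/-- With greediness larger than `b` the first edge of the branch is not evaluated. -/
theorem branch_notMem (hb : 0 < b) (hbβ : b < β) (hβα : β ≤ α) (hα : 0 < α)
    (R : PopRule (Fin (2 * α + 1))) :
    ((⟨b + 1, by omega⟩, ⟨α + 1, by omega⟩) : Fin (2 * α + 1) × Fin (2 * α + 1)) ∉
      (problem α b hα).evaluatedEdges R α β := by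
  set G := problem α b hα
  have hbα : b < α := by omega
  have hβ : 0 < β := by omega
  have hG := isArborescence hb hbα hα
  have hadv := isAdvance hb hbα hα hβ hβα
  obtain ⟨n, h1, h2, h3⟩ := exists_second_search hb hbα hα hβ hβα R
  have hmem := h1.mem_iff hadv.toIsBudget h2
  have hF := h1.mem_qFrontier hadv.toIsBudget h2
  set s := (G.lraStep R α β)^[n] G.initState with hs
  have hbT : budget α b β (2 * α) = 1 := by
    unfold budget
    rw [if_pos rfl]
  have hTF : G.target ∈ s.qFrontier := (hF _).2 (Or.inr ⟨rfl, hbT.trans_le hα⟩)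
  have hTt : s.tree G.target ≠ none := (hmem _).2 (hbT.trans_le hα)
  -- The head now contains the fork `b + 1`, so budgets on the branch are at most `α - 1`; those on
  -- the path are at most `α - β`.
  have honly : ∀ v ∈ s.qFrontier, v = G.target := by
    intro v hv
    have := v.isLt
    rcases (hF v).1 hv with h | h
    · refine Fin.ext ?_
      change v.val = 2 * α
      unfold budget at h
      split_ifs at h <;> omega
    · exact h.1
  have hpick : R.pick s.qFrontier (fun v => nodeKey (s.tree v)) = G.target :=
    honly _ (R.pick_mem _ _ ⟨_, hTF⟩)
  have hstep := h1.lraStep_eq_evaluatePath (β := β) h2 hTt hpick ⟨_, hTF⟩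
  have htail : s.tail 1 G.target = [G.source, G.target] := by
    rw [h1.tail_succ G.source_ne_target.symm hTt 0, hadv.par_target]
    rfl
  change _ = G.evaluatePath β (s.tail (budget α b β (2 * α)) G.target) _ at hstep
  obtain ⟨β', rfl⟩ : ∃ k, β = k + 1 := ⟨β - 1, by omega⟩
  rw [hbT, htail, LazyProblem.evaluatePath,
    if_pos (show G.w G.source G.target = (G.lazyW G.source G.target : WithTop ℝ) from rfl)] at hstep
  dsimp only at hstep
  rw [if_pos rfl, hs, ← Function.iterate_succ_apply' (G.lraStep R α (β' + 1))] at hstep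
  rw [LazyProblem.evaluatedEdges_eq_of_halted (n := n.succ) (by rw [hstep]; trivial), hstep]
  dsimp only
  rw [h3]
  -- All evaluated edges end in the target `2 * α` or in a path vertex of number at most `α`, never
  -- in `α + 1`.
  rintro (h | ⟨i, -, hi, h⟩)
  · have : α + 1 = 2 * α := congrArg (fun e => Fin.val e.2) h
    omega
  · have : α + 1 = min i (2 * α) := congrArg (fun e => Fin.val e.2) h
    omega

end ForkedTree

theorem mainTheorem9 (α β₁ β₂ : ℕ) (h₁ : 1 < β₁) (h₁₂ : β₁ < β₂) (h₂ : β₂ ≤ α) :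
    ∃ (V : Type) (_ : Finite V) (G : LazyProblem V), G.DistinctPathCosts ∧
      ∀ R : PopRule V,
        (G.evaluatedEdges R α β₁ \ G.evaluatedEdges R α β₂).Nonempty := by
  have hα : 0 < α := by omega
  -- The fork is placed in `β₁ + 1`, one edge behind the reach of the smaller greediness but within
  -- that of the larger one.
  refine ⟨Fin (2 * α + 1), inferInstance, ForkedTree.problem α β₁ hα,
    ForkedTree.distinctPathCosts (by omega) hα, fun R => ?_⟩
  exact ⟨_, ForkedTree.branch_mem h₁ (by omega) hα R,
    ForkedTree.branch_notMem (by omega) h₁₂ h₂ hα R⟩
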